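/- Let $f:O\to\mathbb{R}^{n_x}$ and $h:O\to\mathbb{R}^{n_y}$ be smooth on a bounded open set $O\subset\mathbb{R}^{n_x}$, and let $X\subset O$ be compact. Consider the system $\dot x=f(x)$, $y=h(x)$ and assume: 1. (Forward completeness within $X$.) For every $x_0\in X$ the solution $x(t)$ with $x(0)=x_0$ exists and lies in $X$ for all $t\ge 0$. 2. (Backward $O$-distinguishability on $X$.) For all distinct $x_1,x_2\in X$ there is $\tau<0$ such that the solutions $\gamma_1,\gamma_2$ with $\gamma_i(0)=x_i$ exist and lie in $O$ on $[\tau,0]$, and $h(\gamma_1(\tau))\ne h(\gamma_2(\tau))$. Let $n_z=n_y(2n_x+1)$, and let $A\in\mathbb{R}^{n_z\times n_z}$ be Hurwitz and $B\in\mathbb{R}^{n_z\times n_y}$ with $(A,B)$ controllable. Let $\mathcal T:X\to\mathbb{R}^{n_z}$ be an injective differentiable map (differentiable relative to $X$) with $$\frac{\partial \mathcal T}{\partial x}(x)f(x)=A\mathcal T(x)+Bh(x)\qquad (x\in X),$$ and let $\mathcal T^*:\mathbb{R}^{n_z}\to\mathbb{R}^{n_x}$ be a left inverse, i.e. $\mathcal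 T^*(\mathcal T(x))=x$ for all $x\in X$. Let $\hat{\mathcal T}^*:\mathbb{R}^{n_z}\to\mathbb{R}^{n_x}$ be a Lipschitz map (the learned approximation of $\mathcal T^*$). For $Z\subset\mathbb{R}^{n_z}$ put $$\epsilon^*(Z)=\sup_{z\in Z}\|\mathcal T^*(z)-\hat{\mathcal T}^*(z)\|.$$ Say that $Z$ contains the trajectories if $z(t)\in Z$ for all $t\ge 0$ whenever $\dot x=f(x)$, $x(0)\in X$, $\dot z=Az+Bh(x)$, $z(0)=\mathcal T(x(0))$. Norms are Euclidean. Then: (i) Every feed-forward neural network $\mathbb{R}^{n_z}\to\mathbb{R}^{n_x}$ with Lipschitz continuous activation functions is a Lipschitz map, so it is admissible as $\hat{\mathcal T}^*$. (ii) There is a compact set $Z$ that contains the trajectories, on which $\mathcal T^*$ is bounded and $\epsilon^*(Z)<\infty$. (iii) Let $Z$ be any compact set that contains the trajectories and on which $\mathcal T^*$ is bounded. Then $\epsilon^*(Z)<\infty$, and there is $c>0$ such that for every $\hat z_0\in\mathbb{R}^{n_z}$ there is $b>0$ with the following property. For every solution of $\dot x=f(x)$ with $x(0)\in X$, the learned observer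 $$\dot{\hat z}=A\hat z+Bh(x),\quad \hat z(0)=\hat z_0,\qquad \hat x=\hat{\mathcal T}^*(\hat z)$$ satisfies $$\|\hat x(t)-x(t)\|\le b\,e^{-ct}+\epsilon^*(Z)\qquad\text{for all } t\ge 0 .$$ -/

import Mathlib

open Set
open scoped ContDiff

noncomputable section

namespace KKL

/-- The space `ℝⁿ` with its Euclidean norm. -/
abbrev E (n : ℕ) : Type := EuclideanSpace ℝ (Fin n)

/-- `x` is a solution of the autonomous equation `ẋ = f(x)` on the set of times `I`. -/
def IsSolution {n : ℕ} (f : E n → E n) (x : ℝ → E n) (I : Set ℝ) : Prop :=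
  IsIntegralCurveOn x (fun _ => f) I

/-- `ẋ = f(x)` is forward complete within `X`: from every point of `X` there starts a solution
defined for all `t ≥ 0` that remains in `X`. -/
def ForwardComplete {n : ℕ} (f : E n → E n) (X : Set (E n)) : Prop :=
  ∀ x₀ ∈ X, ∃ x : ℝ → E n, IsSolution f x (Ici 0) ∧ x 0 = x₀ ∧ ∀ t, 0 ≤ t → x t ∈ X

/-- Backward `O`-distinguishability on `X` of the system `ẋ = f(x)`, `y = h(x)`: for two distinct
initial conditions in `X` there is a time `τ < 0` such that both solutions are defined and stay in
`O` on `[τ, 0]`, and their outputs at time `τ` differ. -/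
def BackwardDistinguishable {n p : ℕ} (f : E n → E n) (h : E n → E p) (O X : Set (E n)) : Prop :=
  ∀ x₁ ∈ X, ∀ x₂ ∈ X, x₁ ≠ x₂ → ∃ τ < 0, ∃ γ₁ γ₂ : ℝ → E n,
    (IsSolution f γ₁ (Icc τ 0) ∧ γ₁ 0 = x₁ ∧ ∀ t ∈ Icc τ 0, γ₁ t ∈ O) ∧
    (IsSolution f γ₂ (Icc τ 0) ∧ γ₂ 0 = x₂ ∧ ∀ t ∈ Icc τ 0, γ₂ t ∈ O) ∧
    h (γ₁ τ) ≠ h (γ₂ τ)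

/-- The matrix–vector product as a map of Euclidean spaces. -/
def act {m n : ℕ} (M : Matrix (Fin m) (Fin n) ℝ) (v : E n) : E m := Matrix.toEuclideanLin M v

/-- A real square matrix is Hurwitz if all its complex eigenvalues have negative real part. -/
def Hurwitz {n : ℕ} (A : Matrix (Fin n) (Fin n) ℝ) : Prop :=
  ∀ μ ∈ spectrum ℂ (A.map (algebraMap ℝ ℂ)), μ.re < 0

/-- Kalman's rank condition: the block matrix `[B, AB, …, A^(n-1) B]` has rank `n`. -/
def Controllable {n p : ℕ} (A : Matrix (Fin n) (Fin n) ℝ) (B : Matrix (Fin n) (Fin p) ℝ) : Prop :=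
  (Matrix.of fun (i : Fin n) (kj : Fin n × Fin p) => (A ^ (kj.1 : ℕ) * B) i kj.2).rank = n

/-- `T` is an injective map on `X` that satisfies `(∂T/∂x)(x) f(x) = A T(x) + B h(x)` for every
`x ∈ X`; the derivative is a Fréchet derivative relative to `X`. -/
def IsKKLTransformation {n m p : ℕ} (f : E n → E n) (h : E n → E p) (X : Set (E n))
    (A : Matrix (Fin m) (Fin m) ℝ) (B : Matrix (Fin m) (Fin p) ℝ) (T : E n → E m) : Prop :=
  InjOn T X ∧
  ∀ x ∈ X, ∃ T' : E n →L[ℝ] E m, HasFDerivWithinAt T T' X x ∧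
    T' (f x) = act A (T x) + act B (h x)

/-- `z` solves `ż = A z + B y(t)` for `t ≥ 0` with `z(0) = z₀`. -/
def IsLinearResponse {m p : ℕ} (A : Matrix (Fin m) (Fin m) ℝ) (B : Matrix (Fin m) (Fin p) ℝ)
    (y : ℝ → E p) (z₀ : E m) (z : ℝ → E m) : Prop :=
  IsIntegralCurveOn z (fun t v => act A v + act B (y t)) (Ici 0) ∧ z 0 = z₀

/-- `Z` contains, for all `t ≥ 0` and all `x(0) ∈ X`, the solution of `ż = A z + B h(x(t))` with
`z(0) = T(x(0))`. -/
def ContainsTrajectories {n m p : ℕ} (f : E n → E n) (h : E n → E p) (X : Set (E n))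
    (A : Matrix (Fin m) (Fin m) ℝ) (B : Matrix (Fin m) (Fin p) ℝ) (T : E n → E m)
    (Z : Set (E m)) : Prop :=
  ∀ x : ℝ → E n, IsSolution f x (Ici 0) → x 0 ∈ X →
    ∀ z : ℝ → E m, IsLinearResponse A B (fun t => h (x t)) (T (x 0)) z →
      ∀ t, 0 ≤ t → z t ∈ Z

/-- The set of the approximation errors `‖T*(z) - T̂*(z)‖`, `z ∈ Z`. -/
def approxErrors {n m : ℕ} (Tinv That : E m → E n) (Z : Set (E m)) : Set ℝ :=
  (fun z => ‖Tinv z - That z‖) '' Z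

/-- Feed-forward networks with input dimension `m` and output dimension `n`: finitely many hidden
layers (weights, biases, one activation function per neuron), followed by an affine output layer. -/
inductive Network : ℕ → ℕ → Type
  | output {m n : ℕ} (W : Matrix (Fin n) (Fin m) ℝ) (b : E n) : Network m n
  | hidden {m k n : ℕ} (W : Matrix (Fin k) (Fin m) ℝ) (b : E k) (σ : Fin k → ℝ → ℝ)
      (N : Network k n) : Network m n

/-- The function computed by a network. -/
def Network.eval : {m n : ℕ} → Network m n → E m → E n
  | _, _, .output W b, v => act W v + b
  | _, _, .hidden W b σ N, v => N.eval (WithLp.toLp 2 fun i => σ i ((act W v + b) i))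

/-- All activation functions of the network are Lipschitz continuous. -/
def Network.LipschitzActivations : {m n : ℕ} → Network m n → Prop
  | _, _, .output _ _ => True
  | _, _, .hidden _ _ σ N => (∀ i, ∃ K, LipschitzWith K (σ i)) ∧ N.LipschitzActivations

end KKL

end

namespace KKL

open Polynomial Filter Topology

/-! The equation for `T` says that `T (x t)` is itself a response of the filter driven by `h (x t)`.
Hence `e = ẑ - T(x)` solves `ė = A e` and decays exponentially. A Lipschitz `That` carries this
decay over to the estimate, and what remains is `That - Tinv` at `T (x t)`, a point of `Z`. For
existence, `Z = T(X)` works.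

Two facts carry this. `Hurwitz.exists_norm_le` gives the decay without matrix exponentials: by
Cayley–Hamilton the characteristic polynomial annihilates every solution, and its linear factors are
peeled off one at a time. `ForwardComplete.mem` keeps every solution in `X`, by uniqueness. -/

/-- A solution of `w' = μ w + g` decays at the rate of the forcing term `g` if this rate is slower
than that of the homogeneous equation. -/
theorem norm_le_mul_exp_of_hasDerivWithinAt {V : Type*} [NormedAddCommGroup V] [NormedSpace ℂ V]
    [NormedSpace ℝ V] [IsScalarTower ℝ ℂ V] {μ : ℂ} {c C : ℝ} (hμ : μ.re < -c) (hC : 0 ≤ C)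
    {w g : ℝ → V} (hw : ∀ t, 0 ≤ t → HasDerivWithinAt w (μ • w t + g t) (Ici 0) t)
    (hg : ∀ t, 0 ≤ t → ‖g t‖ ≤ C * Real.exp (-c * t)) {t : ℝ} (ht : 0 ≤ t) :
    ‖w t‖ ≤ (‖w 0‖ + C / (-c - μ.re)) * Real.exp (-c * t) := by
  have hδ : 0 < -c - μ.re := by linarith
  set δ := -c - μ.re with hδdef
  have hexp : ∀ s : ℝ, HasDerivAt (fun s : ℝ => Complex.exp (-μ * s))
      (Complex.exp (-μ * s) * -μ) s := fun s => by
    simpa using ((Complex.ofRealCLM.hasDerivAt (x := s)).const_mul (-μ)).cexp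
  have hnorm : ∀ s : ℝ, ‖Complex.exp (-μ * s)‖ = Real.exp (-μ.re * s) := fun s => by
    simp [Complex.norm_exp]
  -- The integrating factor removes the term `μ • w`.
  have hu : ∀ s : ℝ, 0 ≤ s → HasDerivWithinAt (fun s : ℝ => Complex.exp (-μ * s) • w s)
      (Complex.exp (-μ * s) • g s) (Ici 0) s := fun s hs => by
    refine ((hexp s).hasDerivWithinAt.smul (hw s hs)).congr_deriv ?_
    module
  have hB : ∀ s, HasDerivAt (fun s => ‖w 0‖ + C / δ * Real.exp (δ * s))
      (C * Real.exp (δ * s)) s := fun s => by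
    refine (((((hasDerivAt_id s).const_mul δ).exp).const_mul (C / δ)).const_add ‖w 0‖).congr_deriv ?_
    simp only [id]
    field_simp
  have key := image_norm_le_of_norm_deriv_right_le_deriv_boundary (a := 0) (b := t)
    (fun s hs => (hu s hs.1).continuousWithinAt.mono Icc_subset_Ici_self)
    (fun s hs => (hu s hs.1).mono (Ici_subset_Ici.2 hs.1))
    (by simpa using div_nonneg hC hδ.le) (B := fun s => ‖w 0‖ + C / δ * Real.exp (δ * s)) hB
    (fun s hs => by
      rw [norm_smul, hnorm]
      calc _ ≤ Real.exp (-μ.re * s) * (C * Real.exp (-c * s)) := by gcongr; exact hg s hs.1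
        _ = C * (Real.exp (-μ.re * s) * Real.exp (-c * s)) := by ring
        _ = C * Real.exp (δ * s) := by rw [← Real.exp_add]; congr 2; rw [hδdef]; ring)
    ⟨ht, le_rfl⟩
  rw [norm_smul, hnorm] at key
  have h1 : ‖w t‖ = Real.exp (μ.re * t) * (Real.exp (-μ.re * t) * ‖w t‖) := by
    rw [← mul_assoc, ← Real.exp_add]; simp
  have h2 : Real.exp (μ.re * t) * Real.exp (δ * t) = Real.exp (-c * t) := by
    rw [← Real.exp_add]; congr 1; rw [hδdef]; ring
  have h3 : Real.exp (μ.re * t) ≤ Real.exp (-c * t) := by gcongr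
  calc ‖w t‖ ≤ Real.exp (μ.re * t) * (‖w 0‖ + C / δ * Real.exp (δ * t)) := by
        rw [h1]; gcongr
    _ = Real.exp (μ.re * t) * ‖w 0‖ + C / δ * Real.exp (-c * t) := by rw [← h2]; ring
    _ ≤ Real.exp (-c * t) * ‖w 0‖ + C / δ * Real.exp (-c * t) := by gcongr
    _ = _ := by ring

/-- Solutions of `w' = L w` that are annihilated by a product of factors `L - μ`, `Re μ < -c`,
decay at the rate `c`. -/
theorem exists_norm_le_of_prod_sub_eq_zero {V : Type*} [NormedAddCommGroup V] [NormedSpace ℂ V]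
    [NormedSpace ℝ V] [IsScalarTower ℝ ℂ V] (L : V →L[ℂ] V) {c : ℝ} (s : Multiset ℂ) :
    (∀ μ ∈ s, μ.re < -c) → ∃ K, 0 ≤ K ∧ ∀ w : ℝ → V,
      (∀ t, 0 ≤ t → HasDerivWithinAt w (L (w t)) (Ici 0) t) →
      (∀ t, aeval L (s.map fun μ => X - C μ).prod (w t) = 0) →
      ∀ t, 0 ≤ t → ‖w t‖ ≤ K * ‖w 0‖ * Real.exp (-c * t) := by
  induction s using Multiset.induction_on with
  | empty =>
    intro _
    -- The empty product is the identity, so `w` vanishes.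
    refine ⟨0, le_rfl, fun w _ h t _ => ?_⟩
    have := h t
    simp at this
    simp [this]
  | cons μ s ih =>
    intro hs
    obtain ⟨K, hK, hdecay⟩ := ih fun ν hν => hs ν (Multiset.mem_cons_of_mem hν)
    have hμ := hs μ (Multiset.mem_cons_self μ s)
    have hδ : 0 < -c - μ.re := by linarith
    let M : V →L[ℂ] V := L - μ • 1
    have hM : ∀ v, M v = L v - μ • v := fun v => rfl
    refine ⟨1 + K * ‖M‖ / (-c - μ.re), by positivity, fun w hw hann t ht => ?_⟩
    -- `M` commutes with `L`, so `M w` solves the same equation and is annihilated by the remaining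
    -- factors. It is then the forcing term in `w' = μ w + M w`.
    have hg : ∀ t, 0 ≤ t → ‖M (w t)‖ ≤ K * (‖M‖ * ‖w 0‖) * Real.exp (-c * t) := fun t ht => by
      refine (hdecay (fun t => M (w t)) (fun t ht => ?_) (fun t => ?_) t ht).trans ?_
      · have h1 := ((M.restrictScalars ℝ).hasFDerivAt.comp_hasDerivWithinAt t (hw t ht))
        have h2 : L (M (w t)) = M (L (w t)) := by simp [hM]
        rw [h2]
        exact h1
      · have := hann t
        rw [Multiset.map_cons, Multiset.prod_cons, mul_comm, map_mul] at this
        simpa [hM, Algebra.algebraMap_eq_smul_one] using this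
      · gcongr
        exact M.le_opNorm _
    have := norm_le_mul_exp_of_hasDerivWithinAt hμ (by positivity)
      (w := w) (g := fun t => M (w t))
      (fun t ht => by simpa [hM] using hw t ht) hg ht
    refine this.trans_eq ?_
    ring

/-- Solutions of `ż = A z` with `A` Hurwitz decay exponentially. -/
theorem Hurwitz.exists_norm_le {n : ℕ} {A : Matrix (Fin n) (Fin n) ℝ} (hA : Hurwitz A) :
    ∃ c > 0, ∃ K, 0 ≤ K ∧ ∀ e : ℝ → E n,
      (∀ t, 0 ≤ t → HasDerivWithinAt e (act A (e t)) (Ici 0) t) →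
      ∀ t, 0 ≤ t → ‖e t‖ ≤ K * ‖e 0‖ * Real.exp (-c * t) := by
  let A' : Matrix (Fin n) (Fin n) ℂ := A.map (algebraMap ℝ ℂ)
  have hneg : ∀ μ ∈ A'.charpoly.roots, μ.re < 0 := fun μ hμ =>
    hA μ (Matrix.mem_spectrum_iff_isRoot_charpoly.2 (isRoot_of_mem_roots hμ))
  -- There are finitely many eigenvalues, so a strict gap is available; it absorbs the polynomial
  -- factors of Jordan blocks.
  obtain ⟨c, hc0, hc⟩ : ∃ c > 0, ∀ μ ∈ A'.charpoly.roots, μ.re < -c := by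
    have h : ∀ᶠ c : ℝ in 𝓝[>] 0, ∀ μ ∈ A'.charpoly.roots.toFinset, μ.re < -c := by
      refine (Filter.eventually_all_finset _).2 fun μ hμ => ?_
      have := hneg μ (Multiset.mem_toFinset.1 hμ)
      filter_upwards [nhdsWithin_le_nhds (Iio_mem_nhds (show (0 : ℝ) < -μ.re by linarith))]
        with c hc
      have : c < -μ.re := hc
      linarith
    obtain ⟨c, h1, h2⟩ := (h.and self_mem_nhdsWithin).exists
    exact ⟨c, h2, fun μ hμ => h1 μ (Multiset.mem_toFinset.2 hμ)⟩
  let L := Matrix.toEuclideanCLM (n := Fin n) (𝕜 := ℂ) A'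
  obtain ⟨K, hK, hdecay⟩ := exists_norm_le_of_prod_sub_eq_zero L A'.charpoly.roots hc
  refine ⟨c, hc0, K, hK, fun e he t ht => ?_⟩
  have hroots : (A'.charpoly.roots.map fun μ => X - C μ).prod = A'.charpoly :=
    ((IsAlgClosed.splits _).eq_prod_roots_of_monic A'.charpoly_monic).symm
  have hann : aeval L A'.charpoly = 0 := by
    have h := aeval_algHom_apply
      (Matrix.toEuclideanCLM (n := Fin n) (𝕜 := ℂ)).toAlgEquiv.toAlgHom A' A'.charpoly
    rw [Matrix.aeval_self_charpoly, map_zero] at h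
    exact h
  -- Isometric complexification, intertwining `A` with `L`.
  let ι : E n →ₗ[ℝ] EuclideanSpace ℂ (Fin n) :=
    { toFun := fun v => WithLp.toLp 2 fun i => (v i : ℂ)
      map_add' := fun v w => by ext i; simp
      map_smul' := fun r v => by ext i; simp }
  have hι : ∀ v, ‖ι v‖ = ‖v‖ := fun v => by simp [ι, EuclideanSpace.norm_eq]
  have hL : ∀ v, L (ι v) = ι (act A v) := fun v => by
    ext i
    simp [ι, L, A', act, Matrix.toLpLin_apply, Matrix.mulVec, dotProduct]
  have := hdecay (fun t => ι (e t))
    (fun t ht => by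
      rw [hL]
      exact ι.toContinuousLinearMap.hasFDerivAt.comp_hasDerivWithinAt t (he t ht))
    (fun t => by rw [hroots, hann]; rfl) t ht
  simpa [hι] using this

theorem exists_lipschitzWith_act {m n : ℕ} (W : Matrix (Fin m) (Fin n) ℝ) :
    ∃ l, LipschitzWith l (act W) :=
  ⟨_, (Matrix.toEuclideanLin W).toContinuousLinearMap.lipschitz⟩

theorem Network.exists_lipschitzWith_eval {m n : ℕ} (N : Network m n) :
    N.LipschitzActivations → ∃ l, LipschitzWith l N.eval := by
  induction N with
  | output W b =>
    intro _
    obtain ⟨l, hl⟩ := exists_lipschitzWith_act W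
    exact ⟨l, LipschitzWith.of_dist_le_mul fun v w => by
      simpa [Network.eval] using hl.dist_le_mul v w⟩
  | @hidden m k n W b σ N ih =>
    rintro ⟨hσ, hN⟩
    obtain ⟨l, hl⟩ := ih hN
    obtain ⟨l', hl'⟩ := exists_lipschitzWith_act W
    choose κ hκ using hσ
    have h1 : LipschitzWith l' fun v => act W v + b := LipschitzWith.of_dist_le_mul fun v w => by
      simpa using hl'.dist_le_mul v w
    have h2 : LipschitzWith (∑ i, κ i) fun (v : Fin k → ℝ) i => σ i (v i) :=
      LipschitzWith.of_dist_le_mul fun v w => by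
        refine (dist_pi_le_iff (by positivity)).2 fun i => ?_
        calc _ ≤ (κ i : ℝ) * dist (v i) (w i) := (hκ i).dist_le_mul _ _
          _ ≤ _ := by
            gcongr
            · exact Finset.single_le_sum (fun _ _ => zero_le) (Finset.mem_univ i)
            · exact dist_le_pi_dist v w i
    exact ⟨_, hl.comp ((PiLp.lipschitzWith_toLp 2 _).comp
      (h2.comp ((PiLp.lipschitzWith_ofLp 2 _).comp h1)))⟩

/-- Two solutions with the same initial value agree as long as one of them stays in an open set on
which the vector field is `C¹`. -/
theorem IsSolution.eqOn {n : ℕ} {f : E n → E n} {O : Set (E n)} (hO : IsOpen O)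
    (hf : ContDiffOn ℝ 1 f O) {x y : ℝ → E n} (hx : IsSolution f x (Ici 0))
    (hy : IsSolution f y (Ici 0)) (h0 : x 0 = y 0) (hyO : ∀ t, 0 ≤ t → y t ∈ O) :
    EqOn x y (Ici 0) := by
  have hxc : ContinuousOn x (Ici 0) := fun t ht => (hx t ht).continuousWithinAt
  have hyc : ContinuousOn y (Ici 0) := fun t ht => (hy t ht).continuousWithinAt
  intro b hb
  have hclosed : IsClosed ({t | x t = y t} ∩ Icc 0 b) := by
    have := (hxc.mono fun s (hs : s ∈ Icc 0 b) => hs.1).prodMk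
      (hyc.mono fun s (hs : s ∈ Icc 0 b) => hs.1)
      |>.preimage_isClosed_of_isClosed isClosed_Icc isClosed_diagonal
    rw [inter_comm]
    exact this
  refine hclosed.Icc_subset_of_forall_mem_nhdsWithin h0 (fun t ht => ?_) ⟨hb, le_rfl⟩
  have hxy : x t = y t := ht.1
  have ht0 : 0 ≤ t := ht.2.1
  obtain ⟨K, U, hU, hlip⟩ :=
    (hf.contDiffAt (hO.mem_nhds (hyO t ht0))).exists_lipschitzOnWith
  -- Only `y` is known to stay in `O`; `x` stays in `U` for a short time because it agrees with `y`
  -- at `t`.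
  have hmem : ∀ᶠ s in 𝓝[≥] t, x s ∈ U ∧ y s ∈ U := by
    have hsub : Ici t ⊆ Ici (0 : ℝ) := Ici_subset_Ici.2 ht0
    exact (((hxc t ht0).mono hsub).eventually_mem (hxy ▸ hU)).and
      (((hyc t ht0).mono hsub).eventually_mem hU)
  obtain ⟨r, hr, hrU⟩ := mem_nhdsGE_iff_exists_Ico_subset.1 hmem
  have key : EqOn x y (Icc t ((t + r) / 2)) := by
    have hr' : t < r := hr
    have hsub : ∀ s ∈ Ico t ((t + r) / 2), s ∈ Ico t r := fun s hs => ⟨hs.1, by linarith [hs.2]⟩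
    refine ODE_solution_unique_of_mem_Icc_right (v := fun _ => f) (s := fun _ => U)
      (fun _ _ => hlip) (hxc.mono fun s hs => ht0.trans hs.1)
      (fun s hs => (hx s (ht0.trans hs.1)).mono (Ici_subset_Ici.2 (ht0.trans hs.1)))
      (fun s hs => (hrU (hsub s hs)).1) (hyc.mono fun s hs => ht0.trans hs.1)
      (fun s hs => (hy s (ht0.trans hs.1)).mono (Ici_subset_Ici.2 (ht0.trans hs.1)))
      (fun s hs => (hrU (hsub s hs)).2) hxy
  refine mem_of_superset (Icc_mem_nhdsGT ?_) key
  have : t < r := hr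
  linarith

/-- Every solution that starts in `X` is the one that forward completeness provides, so it stays
in `X`. -/
theorem ForwardComplete.mem {n : ℕ} {f : E n → E n} {X O : Set (E n)} (hfwd : ForwardComplete f X)
    (hO : IsOpen O) (hXO : X ⊆ O) (hf : ContDiffOn ℝ 1 f O) {x : ℝ → E n}
    (hx : IsSolution f x (Ici 0)) (hx0 : x 0 ∈ X) {t : ℝ} (ht : 0 ≤ t) : x t ∈ X := by
  obtain ⟨y, hy, hy0, hyX⟩ := hfwd _ hx0
  rw [hx.eqOn hO hf hy hy0.symm (fun t ht => hXO (hyX t ht)) ht]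
  exact hyX t ht

/-- Chain rule along `x`. The derivative of `T` is only relative to `X`, so the solution has to stay
in `X`. -/
theorem IsKKLTransformation.isLinearResponse {n m p : ℕ} {f : E n → E n} {h : E n → E p}
    {X : Set (E n)} {A : Matrix (Fin m) (Fin m) ℝ} {B : Matrix (Fin m) (Fin p) ℝ} {T : E n → E m}
    (hT : IsKKLTransformation f h X A B T) {x : ℝ → E n} (hx : IsSolution f x (Ici 0))
    (hxX : ∀ t, 0 ≤ t → x t ∈ X) :
    IsLinearResponse A B (fun t => h (x t)) (T (x 0)) fun t => T (x t) := by
  refine ⟨fun t ht => ?_, rfl⟩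
  obtain ⟨T', hT', heq⟩ := hT.2 _ (hxX t ht)
  show HasDerivWithinAt (T ∘ x) (act A (T (x t)) + act B (h (x t))) (Ici 0) t
  rw [← heq]
  exact hT'.comp_hasDerivWithinAt t (hx t ht) hxX

theorem IsLinearResponse.hasDerivWithinAt_sub {m p : ℕ} {A : Matrix (Fin m) (Fin m) ℝ}
    {B : Matrix (Fin m) (Fin p) ℝ} {y : ℝ → E p} {z₁ z₂ : E m} {w₁ w₂ : ℝ → E m}
    (h₁ : IsLinearResponse A B y z₁ w₁) (h₂ : IsLinearResponse A B y z₂ w₂) {t : ℝ}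
    (ht : 0 ≤ t) :
    HasDerivWithinAt (fun t => w₁ t - w₂ t) (act A (w₁ t - w₂ t)) (Ici 0) t := by
  have heq : act A (w₁ t - w₂ t) =
      (act A (w₁ t) + act B (y t)) - (act A (w₂ t) + act B (y t)) := by
    simp [act]
  rw [heq]
  exact (h₁.1 t ht).sub (h₂.1 t ht)

theorem Hurwitz.linearResponse_unique {m p : ℕ} {A : Matrix (Fin m) (Fin m) ℝ}
    {B : Matrix (Fin m) (Fin p) ℝ} (hA : Hurwitz A) {y : ℝ → E p} {z₀ : E m} {w₁ w₂ : ℝ → E m}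
    (h₁ : IsLinearResponse A B y z₀ w₁) (h₂ : IsLinearResponse A B y z₀ w₂) {t : ℝ}
    (ht : 0 ≤ t) : w₁ t = w₂ t := by
  obtain ⟨c, _, K, _, hdecay⟩ := hA.exists_norm_le
  have := hdecay _ (fun t ht => h₁.hasDerivWithinAt_sub h₂ ht) t ht
  simpa [h₁.2, h₂.2, sub_eq_zero] using this

theorem bddAbove_approxErrors {n m : ℕ} {Tinv That : E m → E n} {Z : Set (E m)}
    (hZ : IsCompact Z) (hTinv : Bornology.IsBounded (Tinv '' Z)) (hThat : Continuous That) :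
    BddAbove (approxErrors Tinv That Z) := by
  obtain ⟨C₁, h₁⟩ := hTinv.exists_norm_le
  obtain ⟨C₂, h₂⟩ := hZ.exists_bound_of_continuousOn hThat.continuousOn
  refine ⟨C₁ + C₂, ?_⟩
  rintro _ ⟨z, hz, rfl⟩
  exact (norm_sub_le _ _).trans (add_le_add (h₁ _ (mem_image_of_mem _ hz)) (h₂ z hz))

end KKL

theorem mainTheorem1 {nx ny nz : ℕ} (hdim : nz = ny * (2 * nx + 1))
    (f : KKL.E nx → KKL.E nx) (h : KKL.E nx → KKL.E ny) (X O : Set (KKL.E nx))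
    (hX : IsCompact X) (hO : IsOpen O) (hObdd : Bornology.IsBounded O) (hXO : X ⊆ O)
    (hf : ContDiffOn ℝ ∞ f O) (hh : ContDiffOn ℝ ∞ h O)
    (hfwd : KKL.ForwardComplete f X) (hbwd : KKL.BackwardDistinguishable f h O X)
    (A : Matrix (Fin nz) (Fin nz) ℝ) (B : Matrix (Fin nz) (Fin ny) ℝ)
    (hA : KKL.Hurwitz A) (hAB : KKL.Controllable A B)
    (T : KKL.E nx → KKL.E nz) (hT : KKL.IsKKLTransformation f h X A B T)
    (Tinv : KKL.E nz → KKL.E nx) (hTinv : ∀ x ∈ X, Tinv (T x) = x) :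
    -- Networks with Lipschitz activation functions are Lipschitz maps.
    (∀ N : KKL.Network nz nx, N.LipschitzActivations → ∃ l, LipschitzWith l N.eval) ∧
    ∀ That : KKL.E nz → KKL.E nx, (∃ l, LipschitzWith l That) →
      -- There is a compact set that contains the trajectories and has a finite error bound.
      (∃ Z : Set (KKL.E nz), IsCompact Z ∧ KKL.ContainsTrajectories f h X A B T Z ∧
        Bornology.IsBounded (Tinv '' Z) ∧ BddAbove (KKL.approxErrors Tinv That Z)) ∧
      -- On every such set the error bound is finite, and the estimation error obeys it.
      ∀ Z : Set (KKL.E nz), IsCompact Z → KKL.ContainsTrajectories f h X A B T Z →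
        Bornology.IsBounded (Tinv '' Z) →
        BddAbove (KKL.approxErrors Tinv That Z) ∧
        ∃ c > 0, ∀ zhat₀ : KKL.E nz, ∃ b > 0,
          ∀ x : ℝ → KKL.E nx, KKL.IsSolution f x (Ici 0) → x 0 ∈ X →
          ∀ zhat : ℝ → KKL.E nz, KKL.IsLinearResponse A B (fun t => h (x t)) zhat₀ zhat →
          ∀ t : ℝ, 0 ≤ t →
            ‖That (zhat t) - x t‖ ≤
              b * Real.exp (-c * t) + sSup (KKL.approxErrors Tinv That Z) := by
  have hf1 : ContDiffOn ℝ 1 f O := hf.of_le (by exact_mod_cast le_top)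
  have hmem : ∀ x : ℝ → KKL.E nx, KKL.IsSolution f x (Ici 0) → x 0 ∈ X →
      ∀ t, 0 ≤ t → x t ∈ X := fun x hx hx0 t ht => hfwd.mem hO hXO hf1 hx hx0 ht
  have hTX : IsCompact (T '' X) := hX.image_of_continuousOn fun x hx =>
    let ⟨_, hT', _⟩ := hT.2 x hx
    hT'.continuousWithinAt
  refine ⟨fun N => N.exists_lipschitzWith_eval, fun That ⟨l, hl⟩ => ⟨?_, fun Z hZ hZtraj hZbdd =>
    ⟨KKL.bddAbove_approxErrors hZ hZbdd hl.continuous, ?_⟩⟩⟩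
  · have hbdd : Bornology.IsBounded (Tinv '' (T '' X)) := by
      refine hX.isBounded.subset ?_
      rintro _ ⟨_, ⟨x, hx, rfl⟩, rfl⟩
      rwa [hTinv x hx]
    refine ⟨T '' X, hTX, fun x hx hx0 z hz t ht => ?_, hbdd,
      KKL.bddAbove_approxErrors hTX hbdd hl.continuous⟩
    rw [hA.linearResponse_unique hz (hT.isLinearResponse hx (hmem x hx hx0)) ht]
    exact mem_image_of_mem _ (hmem x hx hx0 t ht)
  · obtain ⟨c, hc, K, hK, hdecay⟩ := hA.exists_norm_le
    obtain ⟨R, hR0, hR⟩ := hTX.isBounded.exists_pos_norm_le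
    -- `R` bounds `T` on all of `X`, which makes `b` independent of the solution; the `+ 1` keeps
    -- `b` positive when `l` or `K` is zero.
    refine ⟨c, hc, fun zhat₀ => ⟨l * (K * (‖zhat₀‖ + R)) + 1, by positivity,
      fun x hx hx0 zhat hzhat t ht => ?_⟩⟩
    have hz := hT.isLinearResponse hx (hmem x hx hx0)
    have herr : ‖zhat t - T (x t)‖ ≤ K * (‖zhat₀‖ + R) * Real.exp (-c * t) := by
      refine (hdecay _ (fun t ht => hzhat.hasDerivWithinAt_sub hz ht) t ht).trans ?_
      gcongr
      rw [hzhat.2]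
      exact (norm_sub_le _ _).trans (by gcongr; exact hR _ (mem_image_of_mem _ hx0))
    have hsup : ‖That (T (x t)) - x t‖ ≤ sSup (KKL.approxErrors Tinv That Z) := by
      refine le_csSup (KKL.bddAbove_approxErrors hZ hZbdd hl.continuous)
        ⟨T (x t), hZtraj x hx hx0 _ hz t ht, ?_⟩
      simp only [hTinv _ (hmem x hx hx0 t ht), norm_sub_rev]
    calc ‖That (zhat t) - x t‖
        ≤ ‖That (zhat t) - That (T (x t))‖ + ‖That (T (x t)) - x t‖ :=
          norm_sub_le_norm_sub_add_norm_sub _ _ _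
      _ ≤ l * (K * (‖zhat₀‖ + R) * Real.exp (-c * t)) + sSup (KKL.approxErrors Tinv That Z) := by
          gcongr
          exact (hl.norm_sub_le _ _).trans (by gcongr)
      _ ≤ _ := by
          have := Real.exp_pos (-c * t)
          linarith
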